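/- **Conventions.** A *cut* in a linearly ordered set $I$ is a pair $(D,E)$ of nonempty subsets with $I=D\cup E$ and $d<e$ for all $d\in D$, $e\in E$. Its *cofinality* is $(\kappa,\lambda)$, where $\kappa$ is the cofinality of $D$ and $\lambda$ is the coinitiality of $E$ (the cofinality of $E$ under the reversed order). $I$ is *symmetrically complete* if $\kappa\neq\lambda$ for every cut; *strongly symmetrically complete* if, for every cut, $\kappa\ne\lambda$ and at least one of $\kappa,\lambda$ is uncountable; *extremely symmetrically complete* if it is strongly symmetrically complete and both the cofinality and the coinitiality of $I$ are uncountable. These notions are applied to ordered fields and ordered abelian groups through their underlying ordered sets. Let $K$ be an ordered field. Its *natural valuation* $v$ sends $a$ to its archimedean class, where $a,b$ are archimedean equivalent if $n|a|\ge|b|$ and $n|b|\ge|a|$ for some $n\in\mathbb N$; the classes are ordered by $va>vb$ iff $n|a|<|b|$ for all $n\in\mathbb N$. The *value group* is $vK=\{va: 0\ne a\in K\}$ with $va+vb=v(ab)$, and the *residue field* is the ordered field $\{a: va\ge v1\}/\{a: va>v1\}$; it is said to be $\mathbb R$ if it is isomorphic to $\mathbb R$ as an ordered field. $K$ is *spherically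 complete with respect to $v$* if every nonempty chain, ordered by inclusion, of ultrametric balls $\{g\in K: v(a-g)\ge v(a-b)\}$ ($a,b\in K$) has nonempty intersection. **Theorem.** Let $K$ be an ordered field with natural valuation $v$. Then $K$ is symmetrically complete if and only if it is spherically complete with respect to $v$, has residue field $\mathbb R$, and its value group $vK$ is strongly symmetrically complete. Further, the following are equivalent: (a) $K$ is strongly symmetrically complete; (b) $K$ is extremely symmetrically complete; (c) $K$ is spherically complete with respect to $v$, has residue field $\mathbb R$, and its value group $vK$ is extremely symmetrically complete. -/

import Mathlib

namespace SymmetricCompleteness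

/-- A (Dedekind) cut of a linearly ordered set: nonempty sets `lower` and `upper` that together
exhaust the order, with every element of `lower` strictly below every element of `upper`. -/
structure Cut (I : Type*) [LinearOrder I] where
  lower : Set I
  upper : Set I
  lower_nonempty : lower.Nonempty
  upper_nonempty : upper.Nonempty
  union_eq : lower ∪ upper = Set.univ
  lt_of_mem : ∀ d ∈ lower, ∀ e ∈ upper, d < e

/-- The coinitiality of an order: the cofinality of the reversed order. -/
noncomputable def coinitiality (I : Type*) [Preorder I] : Cardinal :=
  Order.cof Iᵒᵈ

namespace Cut

variable {I : Type*} [LinearOrder I]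

/-- The first component `κ` of the cofinality `(κ, μ)` of a cut. -/
noncomputable def cofLower (C : Cut I) : Cardinal :=
  Order.cof C.lower

/-- The second component `μ` of the cofinality `(κ, μ)` of a cut. -/
noncomputable def coinUpper (C : Cut I) : Cardinal :=
  coinitiality C.upper

def IsAsymmetric (C : Cut I) : Prop :=
  C.cofLower ≠ C.coinUpper

def IsStronglyAsymmetric (C : Cut I) : Prop :=
  C.cofLower ≠ C.coinUpper ∧ (Cardinal.aleph0 < C.cofLower ∨ Cardinal.aleph0 < C.coinUpper)

end Cut

def SymmetricallyComplete (I : Type*) [LinearOrder I] : Prop :=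
  ∀ C : Cut I, C.IsAsymmetric

def StronglySymmetricallyComplete (I : Type*) [LinearOrder I] : Prop :=
  ∀ C : Cut I, C.IsStronglyAsymmetric

def ExtremelySymmetricallyComplete (I : Type*) [LinearOrder I] : Prop :=
  StronglySymmetricallyComplete I ∧
    Cardinal.aleph0 < coinitiality I ∧ Cardinal.aleph0 < Order.cof I

/-- The smallest ultrametric ball containing `a` and `b` for the natural valuation
`v = ArchimedeanClass.mk`, namely `{g | v (a - g) ≥ v (a - b)}`. It is the singleton `{a}` when
`a = b`. Every closed ball of radius `v c` and centre `a` is of this form, with `b = a + c`. -/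
def ultrametricBall {G : Type*} [AddCommGroup G] [LinearOrder G] [IsOrderedAddMonoid G]
    (a b : G) : Set G :=
  {g | ArchimedeanClass.mk (a - b) ≤ ArchimedeanClass.mk (a - g)}

/-- Spherical completeness with respect to the natural valuation: every nonempty chain of
ultrametric balls, ordered by inclusion, has a nonempty intersection. -/
def SphericallyComplete (G : Type*) [AddCommGroup G] [LinearOrder G] [IsOrderedAddMonoid G] :
    Prop :=
  ∀ S : Set (Set G), S.Nonempty → (∀ B ∈ S, ∃ a b : G, B = ultrametricBall a b) →
    IsChain (· ⊆ ·) S → (⋂₀ S).Nonempty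

/-- The residue field of the natural valuation (finite elements modulo infinitesimals, with the
induced order) is isomorphic to `ℝ` as an ordered field. -/
def HasResidueFieldReal (K : Type*) [Field K] [LinearOrder K] [IsStrictOrderedRing K] : Prop :=
  Nonempty (ArchimedeanClass.FiniteResidueField K ≃+*o ℝ)

/-- The value group `vK = {v a | a ≠ 0}` of the natural valuation: the archimedean classes of the
nonzero elements, larger classes consisting of elements of smaller absolute value. Only its
order is relevant for the completeness notions above. -/
abbrev ValueGroup (K : Type*) [Field K] [LinearOrder K] [IsStrictOrderedRing K] : Type _ :=
  FiniteArchimedeanClass K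

end SymmetricCompleteness

/-! The bridge between `K` and `vK` is a cut with a point `a` below it such that the side of any `x
> a` depends only on `v(x - a)`. The valuation reverses order, and integer multiples and fractions
of one positive element exhaust its archimedean class in both directions. Hence a cut of `vK` of
cofinality `(κ, μ)` induces a cut of `K` of cofinality `(max ℵ₀ μ, max ℵ₀ κ)`
(`IsInducedAt.cofLower_eq`, `IsInducedAt.coinUpper_eq`). These cardinals differ exactly when the cut
of `vK` is strongly asymmetric, which is why `vK` must satisfy the strong condition even when `K`
satisfies the plain one.

The other two conditions are necessary because their failure produces a symmetric cut: a chain of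
balls with empty intersection is approached from both sides with the cofinality of the chain, and a
real that is not a standard part yields a cut of cofinality `(ℵ₀, ℵ₀)`.

Conversely, spherical completeness places a point in all balls spanned across a given cut, and
completeness of the residue field `ℝ` corrects this point to a centre
(`exists_isLowerCentre_of_mem_lower`). So, up to negation, every cut is induced from `vK` or has a
greatest element below it. The latter kind has cofinality `(1, μ)` with `μ` infinite, hence is
always asymmetric; it is strongly so when `cof vK` is uncountable. The cut just above `0` shows that
this is also necessary, and inversion carries its coinitiality over to the cofinality of `K`. -/

namespace SymmetricCompleteness

open Cardinal Order

universe u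

/-! ### Comparison of cofinalities. -/

section Cofinality

variable {α β : Type u}

/-- A Tukey reduction from `α` to `β` bounds the cofinality of `α` by that of `β`. -/
theorem cof_le_of_tukey [Preorder α] [Preorder β] (f : α → β) (g : β → α)
    (h : ∀ a b, f a ≤ b → a ≤ g b) : cof α ≤ cof β := by
  obtain ⟨s, hs, hcard⟩ := exists_cof_eq β
  rw [← hcard]
  refine (cof_le (s := g '' s) fun a => ?_).trans mk_image_le
  obtain ⟨b, hb, hab⟩ := hs (f a)
  exact ⟨g b, ⟨b, hb, rfl⟩, h a b hab⟩

/-- If every element of `α` is bounded, for all large `b : β`, by one of the countably many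
elements `f b n`, then `α` has at most the cofinality of `β`, up to a countable factor. -/
theorem cof_le_max_aleph0 [Preorder α] [Preorder β] (f : β → ℕ → α)
    (h : ∀ a, ∃ b₀, ∀ b, b₀ ≤ b → ∃ n, a ≤ f b n) : cof α ≤ max ℵ₀ (cof β) := by
  obtain ⟨s, hs, hcard⟩ := exists_cof_eq β
  rw [← hcard]
  have hcof : IsCofinal (Set.range fun p : s × ULift.{u} ℕ => f p.1 p.2.down) := by
    intro a
    obtain ⟨b₀, hb₀⟩ := h a
    obtain ⟨b, hb, hle⟩ := hs b₀
    obtain ⟨n, hn⟩ := hb₀ b hle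
    exact ⟨_, ⟨(⟨b, hb⟩, ⟨n⟩), rfl⟩, hn⟩
  refine (cof_le hcof).trans (mk_range_le.trans ?_)
  rw [mk_prod]
  refine (mul_le_max _ _).trans ?_
  simp [max_comm]

end Cofinality

/-! ### Cuts: their two cofinalities and their negation. -/

namespace Cut

variable {I : Type*} [LinearOrder I] (C : Cut I)

theorem mem_lower_or_mem_upper (x : I) : x ∈ C.lower ∨ x ∈ C.upper := by
  have : x ∈ C.lower ∪ C.upper := by rw [C.union_eq]; trivial
  exact this

theorem notMem_lower_iff {x : I} : x ∉ C.lower ↔ x ∈ C.upper :=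
  ⟨(C.mem_lower_or_mem_upper x).resolve_left, fun h h' => (C.lt_of_mem x h' x h).false⟩

theorem notMem_upper_iff {x : I} : x ∉ C.upper ↔ x ∈ C.lower := by
  rw [← C.notMem_lower_iff, not_not]

theorem cofLower_eq_one_of_isGreatest {a : I} (ha : a ∈ C.lower) (h : ∀ d ∈ C.lower, d ≤ a) :
    C.cofLower = 1 :=
  cof_eq_one_iff.2 ⟨⟨a, ha⟩, fun d => h d d.2⟩

theorem aleph0_le_cofLower (h : ∀ d ∈ C.lower, ∃ d' ∈ C.lower, d < d') : ℵ₀ ≤ C.cofLower := by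
  have : Nonempty C.lower := C.lower_nonempty.to_subtype
  have : NoMaxOrder C.lower := ⟨fun d => by
    obtain ⟨d', hd', hlt⟩ := h d d.2
    exact ⟨⟨d', hd'⟩, hlt⟩⟩
  exact aleph0_le_cof

theorem aleph0_le_coinUpper (h : ∀ e ∈ C.upper, ∃ e' ∈ C.upper, e' < e) : ℵ₀ ≤ C.coinUpper := by
  have : Nonempty C.upper := C.upper_nonempty.to_subtype
  have : NoMinOrder C.upper := ⟨fun d => by
    obtain ⟨d', hd', hlt⟩ := h d d.2
    exact ⟨⟨d', hd'⟩, hlt⟩⟩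
  exact aleph0_le_cof (α := (C.upper)ᵒᵈ)

theorem cofLower_eq_one_or : C.cofLower = 1 ∨ ℵ₀ ≤ C.cofLower := by
  have : Nonempty C.lower := C.lower_nonempty.to_subtype
  have h0 : C.cofLower ≠ 0 := cof_ne_zero
  rcases lt_or_ge C.cofLower ℵ₀ with h | h
  · left
    have h1 : C.cofLower ≤ 1 := cof_lt_aleph0_iff.1 h
    exact le_antisymm h1 (Cardinal.one_le_iff_ne_zero.2 h0)
  · exact Or.inr h

theorem coinUpper_eq_one_or : C.coinUpper = 1 ∨ ℵ₀ ≤ C.coinUpper := by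
  have : Nonempty C.upper := C.upper_nonempty.to_subtype
  have h0 : C.coinUpper ≠ 0 := cof_ne_zero (α := (C.upper)ᵒᵈ)
  rcases lt_or_ge C.coinUpper ℵ₀ with h | h
  · left
    have h1 : C.coinUpper ≤ 1 := (cof_lt_aleph0_iff (α := (C.upper)ᵒᵈ)).1 h
    exact le_antisymm h1 (Cardinal.one_le_iff_ne_zero.2 h0)
  · exact Or.inr h

/-- The image of a cut under negation. -/
def neg {G : Type*} [AddCommGroup G] [LinearOrder G] [IsOrderedAddMonoid G] (C : Cut G) :
    Cut G where
  lower := {x | -x ∈ C.upper}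
  upper := {x | -x ∈ C.lower}
  lower_nonempty := by
    obtain ⟨e, he⟩ := C.upper_nonempty
    exact ⟨-e, by simpa⟩
  upper_nonempty := by
    obtain ⟨e, he⟩ := C.lower_nonempty
    exact ⟨-e, by simpa⟩
  union_eq := by
    ext x
    simpa using (C.mem_lower_or_mem_upper (-x)).symm
  lt_of_mem d hd e he := neg_lt_neg_iff.1 (C.lt_of_mem _ he _ hd)

section neg

variable {G : Type*} [AddCommGroup G] [LinearOrder G] [IsOrderedAddMonoid G] (C : Cut G)

theorem cofLower_neg : C.neg.cofLower = C.coinUpper :=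
  OrderIso.cof_congr (α := C.neg.lower)
    { toFun := fun x => OrderDual.toDual ⟨-x.1, x.2⟩
      invFun := fun x => ⟨-(OrderDual.ofDual x).1, by simp [neg]⟩
      left_inv := fun x => by simp
      right_inv := fun x => by simp
      map_rel_iff' := fun {x y} => neg_le_neg_iff (a := y.1) (b := x.1) }

theorem coinUpper_neg : C.neg.coinUpper = C.cofLower :=
  OrderIso.cof_congr (α := (C.neg.upper)ᵒᵈ)
    { toFun := fun x => ⟨-(OrderDual.ofDual x).1, (OrderDual.ofDual x).2⟩
      invFun := fun x => OrderDual.toDual ⟨-x.1, by simp [neg]⟩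
      left_inv := fun x => by simp
      right_inv := fun x => by simp
      map_rel_iff' := fun {x y} => neg_le_neg_iff
        (a := (OrderDual.ofDual x).1) (b := (OrderDual.ofDual y).1) }

theorem isStronglyAsymmetric_neg : C.neg.IsStronglyAsymmetric ↔ C.IsStronglyAsymmetric := by
  simp only [IsStronglyAsymmetric, cofLower_neg, coinUpper_neg, ne_comm, or_comm]

theorem isAsymmetric_neg : C.neg.IsAsymmetric ↔ C.IsAsymmetric := by
  simp only [IsAsymmetric, cofLower_neg, coinUpper_neg, ne_comm]

end neg

/-- Replacing finite cofinalities of the two sides by `ℵ₀` leaves different values exactly when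
the cut is strongly asymmetric. -/
theorem isStronglyAsymmetric_iff_max_ne :
    C.IsStronglyAsymmetric ↔ max ℵ₀ C.coinUpper ≠ max ℵ₀ C.cofLower := by
  unfold IsStronglyAsymmetric
  constructor
  · rintro ⟨hne, hlt⟩ heq
    rcases C.cofLower_eq_one_or with h₁ | h₁ <;> rcases C.coinUpper_eq_one_or with h₂ | h₂
    · exact hne (h₁.trans h₂.symm)
    · rw [h₁, max_eq_right h₂, max_eq_left one_lt_aleph0.le] at heq
      rw [h₁, heq] at hlt
      exact hlt.elim one_lt_aleph0.not_gt (lt_irrefl _)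
    · rw [h₂, max_eq_right h₁, max_eq_left one_lt_aleph0.le] at heq
      rw [h₂, ← heq] at hlt
      exact hlt.elim (lt_irrefl _) one_lt_aleph0.not_gt
    · rw [max_eq_right h₁, max_eq_right h₂] at heq
      exact hne heq.symm
  · intro h
    refine ⟨fun heq => h (by rw [heq]), ?_⟩
    by_contra! hle
    exact h (by rw [max_eq_left hle.1, max_eq_left hle.2])

end Cut

/-! ### Cuts of the field induced by cuts of the value group. -/

section Field

variable {K : Type u} [Field K] [LinearOrder K] [IsStrictOrderedRing K]

/-- A positive element in a given archimedean class. -/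
noncomputable def posRep (γ : ValueGroup K) : K := |γ.1.out|

theorem mk_posRep (γ : ValueGroup K) : ArchimedeanClass.mk (posRep γ) = γ.1 := by
  simp [posRep]

theorem posRep_pos (γ : ValueGroup K) : 0 < posRep γ := by
  rw [posRep, abs_pos, ne_eq, ← ArchimedeanClass.mk_eq_top_iff, ArchimedeanClass.mk_out]
  exact γ.2

/-- The archimedean class of `x - a`, for `x` above `a`. -/
def valSub {a x : K} (h : a < x) : ValueGroup K :=
  FiniteArchimedeanClass.mk (x - a) (sub_ne_zero.2 h.ne')

theorem valSub_eq {a x : K} (h : a < x) {γ : ValueGroup K}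
    (hγ : ArchimedeanClass.mk (x - a) = γ.1) : valSub h = γ :=
  Subtype.ext hγ

theorem mk_le_mk_of_le {x y : K} (hx : 0 ≤ x) (hxy : x ≤ y) :
    ArchimedeanClass.mk y ≤ ArchimedeanClass.mk x :=
  ArchimedeanClass.mk_antitoneOn hx (hx.trans hxy) hxy

theorem valSub_anti {a x y : K} (hx : a < x) (hxy : x ≤ y) :
    valSub (hx.trans_le hxy) ≤ valSub hx :=
  mk_le_mk_of_le (sub_nonneg.2 hx.le) (sub_le_sub_right hxy a)

theorem mk_natCast_succ_mul (n : ℕ) (x : K) :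
    ArchimedeanClass.mk (((n : K) + 1) * x) = ArchimedeanClass.mk x := by
  have h : ArchimedeanClass.mk ((n : K) + 1) = 0 := by
    exact_mod_cast ArchimedeanClass.mk_natCast (S := K) n.succ_ne_zero
  rw [ArchimedeanClass.mk_mul, h, zero_add]

theorem mk_div_natCast_succ (n : ℕ) (x : K) :
    ArchimedeanClass.mk (x / ((n : K) + 1)) = ArchimedeanClass.mk x := by
  have hn : ((n : K) + 1) ≠ 0 := by positivity
  rw [← mk_natCast_succ_mul n (x / _), mul_div_cancel₀ _ hn]

theorem exists_le_mul_of_mk_le {x y : K} (hx : 0 < x) (h : ArchimedeanClass.mk x ≤ .mk y) :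
    ∃ n : ℕ, y ≤ ((n : K) + 1) * x := by
  obtain ⟨n, hn⟩ := ArchimedeanClass.mk_le_mk.1 h
  refine ⟨n, (le_abs_self y).trans (hn.trans ?_)⟩
  rw [abs_of_pos hx, nsmul_eq_mul]
  exact mul_le_mul_of_nonneg_right (by linarith) hx.le

/-- The cut `C` of `K` is induced by the cut `C'` of the value group around the centre `a`:
the elements of `C.lower` above `a` are those at a distance with class in `C'.upper`. -/
structure IsInducedAt (C : Cut K) (a : K) (C' : Cut (ValueGroup K)) : Prop where
  mem : a ∈ C.lower
  mem_lower_iff : ∀ {x : K} (h : a < x), x ∈ C.lower ↔ valSub h ∈ C'.upper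

namespace IsInducedAt

variable {C : Cut K} {a : K} {C' : Cut (ValueGroup K)}

theorem lt_of_mem_upper (h : IsInducedAt C a C') {e : K} (he : e ∈ C.upper) : a < e :=
  C.lt_of_mem a h.mem e he

theorem mem_upper_iff (h : IsInducedAt C a C') {x : K} (hx : a < x) :
    x ∈ C.upper ↔ valSub hx ∈ C'.lower := by
  rw [← C.notMem_lower_iff, h.mem_lower_iff hx, C'.notMem_upper_iff]

theorem add_mem_lower (h : IsInducedAt C a C') {x : K} (hx : 0 < x) {γ : ValueGroup K}
    (hγ : γ ∈ C'.upper) (hm : ArchimedeanClass.mk x = γ.1) : a + x ∈ C.lower := by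
  rw [h.mem_lower_iff (lt_add_of_pos_right a hx),
    valSub_eq (lt_add_of_pos_right a hx) (γ := γ) (by rwa [add_sub_cancel_left])]
  exact hγ

theorem add_mem_upper (h : IsInducedAt C a C') {x : K} (hx : 0 < x) {γ : ValueGroup K}
    (hγ : γ ∈ C'.lower) (hm : ArchimedeanClass.mk x = γ.1) : a + x ∈ C.upper := by
  rw [h.mem_upper_iff (lt_add_of_pos_right a hx),
    valSub_eq (lt_add_of_pos_right a hx) (γ := γ) (by rwa [add_sub_cancel_left])]
  exact hγ

theorem exists_gt (h : IsInducedAt C a C') : ∃ d ∈ C.lower, a < d := by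
  obtain ⟨γ, hγ⟩ := C'.upper_nonempty
  exact ⟨_, h.add_mem_lower (posRep_pos γ) hγ (mk_posRep γ),
    lt_add_of_pos_right a (posRep_pos γ)⟩

/-- Below the cut, the points `a + (n + 1) * posRep γ` with `γ` in `C'.upper` are cofinal, and `d ↦
v(d - a)` recovers the classes. The value is infinite even if `C'.upper` has a least element, since
no class has a largest positive member. -/
theorem cofLower_eq (h : IsInducedAt C a C') : C.cofLower = max ℵ₀ C'.coinUpper := by
  classical
  obtain ⟨γ₀, hγ₀⟩ := C'.upper_nonempty
  apply le_antisymm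
  · refine cof_le_max_aleph0 (α := C.lower) (β := (C'.upper)ᵒᵈ)
      (fun b n => ⟨a + ((n : K) + 1) * posRep b.ofDual.1, h.add_mem_lower
        (mul_pos (by positivity) (posRep_pos _)) b.ofDual.2
        (by rw [mk_natCast_succ_mul, mk_posRep])⟩) ?_
    rintro ⟨d, hd⟩
    by_cases had : a < d
    · refine ⟨OrderDual.toDual ⟨valSub had, (h.mem_lower_iff had).1 hd⟩, fun b hb => ?_⟩
      have hb' : b.ofDual.1 ≤ valSub had := hb
      obtain ⟨n, hn⟩ := exists_le_mul_of_mk_le (posRep_pos b.ofDual.1) (y := d - a)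
        (by rw [mk_posRep]; exact hb')
      exact ⟨n, sub_le_iff_le_add'.1 hn⟩
    -- Points not above `a` have no class to use, but any class of `C'.upper` bounds them; `γ₀` is
    -- an arbitrary default.
    · refine ⟨OrderDual.toDual ⟨γ₀, hγ₀⟩, fun b _ => ⟨0, ?_⟩⟩
      have := posRep_pos b.ofDual.1
      change d ≤ a + (((0 : ℕ) : K) + 1) * posRep b.ofDual.1
      push_cast
      linarith
  · refine max_le (C.aleph0_le_cofLower fun d hd => ?_) ?_
    · obtain ⟨d₀, hd₀, had₀⟩ := h.exists_gt
      have hm : max d d₀ ∈ C.lower := by rcases max_choice d d₀ with h' | h' <;> rwa [h']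
      have ham : a < max d d₀ := lt_max_of_lt_right had₀
      -- Doubling the distance from `a` keeps its class, so the point stays below the cut.
      refine ⟨a + (((1 : ℕ) : K) + 1) * (max d d₀ - a), ?_, ?_⟩
      · exact h.add_mem_lower (mul_pos (by positivity) (sub_pos.2 ham))
          ((h.mem_lower_iff ham).1 hm) (mk_natCast_succ_mul 1 _)
      · have := le_max_left d d₀
        push_cast
        linarith
    · refine cof_le_of_tukey (α := (C'.upper)ᵒᵈ) (β := C.lower)
        (fun b => ⟨a + posRep b.ofDual.1, h.add_mem_lower (posRep_pos _) b.ofDual.2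
          (mk_posRep _)⟩)
        (fun d => if had : a < d.1 then
          OrderDual.toDual ⟨valSub had, (h.mem_lower_iff had).1 d.2⟩ else
          OrderDual.toDual ⟨γ₀, hγ₀⟩) ?_
      rintro b ⟨d, hd⟩ hle
      have hle' : a + posRep b.ofDual.1 ≤ d := hle
      have hpos := posRep_pos b.ofDual.1
      have had : a < d := by linarith
      rw [dif_pos had]
      change ArchimedeanClass.mk (d - a) ≤ b.ofDual.1.1
      rw [← mk_posRep]
      exact mk_le_mk_of_le hpos.le (by linarith)

theorem coinUpper_eq (h : IsInducedAt C a C') : C.coinUpper = max ℵ₀ C'.cofLower := by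
  apply le_antisymm
  · refine cof_le_max_aleph0 (α := (C.upper)ᵒᵈ) (β := C'.lower)
      (fun b n => OrderDual.toDual ⟨a + posRep b.1 / ((n : K) + 1), h.add_mem_upper
        (div_pos (posRep_pos _) (by positivity)) b.2
        (by rw [mk_div_natCast_succ, mk_posRep])⟩) ?_
    intro e
    have hae := h.lt_of_mem_upper e.ofDual.2
    refine ⟨⟨valSub hae, (h.mem_upper_iff hae).1 e.ofDual.2⟩, fun b hb => ?_⟩
    have hb' : valSub hae ≤ b.1 := hb
    obtain ⟨n, hn⟩ := exists_le_mul_of_mk_le (sub_pos.2 hae) (y := posRep b.1)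
      (by rw [mk_posRep]; exact hb')
    refine ⟨n, ?_⟩
    change a + posRep b.1 / ((n : K) + 1) ≤ e.ofDual.1
    rw [← le_sub_iff_add_le', div_le_iff₀ (by positivity), mul_comm]
    exact hn
  · refine max_le (C.aleph0_le_coinUpper fun e he => ?_) ?_
    · have hae := h.lt_of_mem_upper he
      -- Halving the distance from `a` keeps its class, so the point stays above the cut.
      refine ⟨a + (e - a) / (((1 : ℕ) : K) + 1), h.add_mem_upper
        (div_pos (sub_pos.2 hae) (by positivity)) ((h.mem_upper_iff hae).1 he)
        (mk_div_natCast_succ 1 _), ?_⟩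
      push_cast
      linarith
    · refine cof_le_of_tukey (α := C'.lower) (β := (C.upper)ᵒᵈ)
        (fun b => OrderDual.toDual ⟨a + posRep b.1, h.add_mem_upper (posRep_pos _) b.2
          (mk_posRep _)⟩)
        (fun e => ⟨valSub (h.lt_of_mem_upper e.ofDual.2),
          (h.mem_upper_iff (h.lt_of_mem_upper e.ofDual.2)).1 e.ofDual.2⟩) ?_
      intro b e hle
      have hle' : e.ofDual.1 ≤ a + posRep b.1 := hle
      have hae := h.lt_of_mem_upper e.ofDual.2
      change b.1.1 ≤ ArchimedeanClass.mk (e.ofDual.1 - a)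
      rw [← mk_posRep]
      exact mk_le_mk_of_le (sub_nonneg.2 hae.le) (by linarith)

/-- A cut induced by a cut of the value group is asymmetric exactly when the latter is strongly
asymmetric. -/
theorem isAsymmetric_iff (h : IsInducedAt C a C') :
    C.IsAsymmetric ↔ C'.IsStronglyAsymmetric := by
  rw [C'.isStronglyAsymmetric_iff_max_ne, Cut.IsAsymmetric, h.cofLower_eq, h.coinUpper_eq]

theorem isStronglyAsymmetric_iff (h : IsInducedAt C a C') :
    C.IsStronglyAsymmetric ↔ C'.IsStronglyAsymmetric := by
  rw [C'.isStronglyAsymmetric_iff_max_ne, C.isStronglyAsymmetric_iff_max_ne, h.cofLower_eq,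
    h.coinUpper_eq, ← max_assoc, ← max_assoc, max_self, ne_comm]

end IsInducedAt

/-- The cut of `K` around `0` induced by a cut of the value group. -/
def inducedCut (C' : Cut (ValueGroup K)) : Cut K where
  lower := {x | ∀ h : 0 < x, valSub h ∈ C'.upper}
  upper := {x | ∃ h : 0 < x, valSub h ∈ C'.lower}
  lower_nonempty := ⟨0, fun h => (lt_irrefl _ h).elim⟩
  upper_nonempty := by
    obtain ⟨γ, hγ⟩ := C'.lower_nonempty
    refine ⟨posRep γ, posRep_pos γ, ?_⟩
    rwa [valSub_eq (posRep_pos γ) (γ := γ) (by rw [sub_zero, mk_posRep])]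
  union_eq := by
    ext x
    simp only [Set.mem_union, Set.mem_ofPred_eq, Set.mem_univ, iff_true]
    rw [or_iff_not_imp_left]
    intro hx
    push Not at hx
    obtain ⟨h, hx⟩ := hx
    exact ⟨h, C'.notMem_upper_iff.1 hx⟩
  lt_of_mem d hd e he := by
    obtain ⟨h, he⟩ := he
    by_contra! hle
    exact ((C'.lt_of_mem _ he _ (hd (h.trans_le hle))).trans_le (valSub_anti h hle)).false.elim

theorem isInducedAt_inducedCut (C' : Cut (ValueGroup K)) : IsInducedAt (inducedCut C') 0 C' where
  mem := fun h => (lt_irrefl _ h).elim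
  mem_lower_iff := fun h => ⟨fun hx => hx h, fun hx _ => hx⟩

/-- A symmetrically complete field has a strongly symmetrically complete value group. -/
theorem SymmetricallyComplete.valueGroup (h : SymmetricallyComplete K) :
    StronglySymmetricallyComplete (ValueGroup K) := fun C' =>
  (isInducedAt_inducedCut C').isAsymmetric_iff.1 (h _)

theorem StronglySymmetricallyComplete.symmetricallyComplete {I : Type*} [LinearOrder I]
    (h : StronglySymmetricallyComplete I) : SymmetricallyComplete I := fun C => (h C).1

/-- A cut of a field whose lower part has a greatest element `a`: the coinitiality of the upper
part is infinite. -/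
theorem aleph0_le_coinUpper_of_isGreatest {C : Cut K} {a : K} (ha : a ∈ C.lower)
    (h : ∀ d ∈ C.lower, d ≤ a) : ℵ₀ ≤ C.coinUpper := by
  refine C.aleph0_le_coinUpper fun e he => ?_
  obtain ⟨e', hae', hlt⟩ := exists_between (C.lt_of_mem a ha e he)
  exact ⟨e', C.notMem_lower_iff.1 fun hmem => (h e' hmem).not_gt hae', hlt⟩

/-- Elements descending to `a` from above must pass below every `a + posRep γ`, so the classes of
their distances to `a` are cofinal in `vK`. -/
theorem cof_valueGroup_le_coinUpper {C : Cut K} {a : K} (ha : a ∈ C.lower)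
    (h : ∀ d ∈ C.lower, d ≤ a) : cof (ValueGroup K) ≤ C.coinUpper := by
  have hlt (e : C.upper) : a < e.1 := C.lt_of_mem a ha _ e.2
  refine cof_le_of_tukey (β := (C.upper)ᵒᵈ)
    (fun b => OrderDual.toDual ⟨a + posRep b, C.notMem_lower_iff.1 fun hm =>
      (h _ hm).not_gt (lt_add_of_pos_right a (posRep_pos b))⟩)
    (fun e => valSub (hlt e.ofDual)) ?_
  intro b e hle
  have hle' : e.ofDual.1 ≤ a + posRep b := hle
  change b.1 ≤ ArchimedeanClass.mk (e.ofDual.1 - a)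
  rw [← mk_posRep]
  exact mk_le_mk_of_le (sub_nonneg.2 (hlt _).le) (by linarith)

end Field

/-! ### Symmetric completeness implies spherical completeness. -/

section Balls

variable {G : Type*} [AddCommGroup G] [LinearOrder G] [IsOrderedAddMonoid G]

theorem mem_ultrametricBall {a b g : G} :
    g ∈ ultrametricBall a b ↔ ArchimedeanClass.mk (a - b) ≤ ArchimedeanClass.mk (a - g) :=
  Iff.rfl

theorem left_mem_ultrametricBall (a b : G) : a ∈ ultrametricBall a b := by
  simp [mem_ultrametricBall]

theorem ordConnected_ultrametricBall (a b : G) : (ultrametricBall a b).OrdConnected := by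
  refine ⟨fun x hx y hy z hz => ?_⟩
  rw [mem_ultrametricBall] at *
  exact (le_min hy hx).trans (ArchimedeanClass.min_le_mk_of_le_of_le
    (sub_le_sub_left hz.2 a) (sub_le_sub_left hz.1 a))

/-- A ball contains elements on either side of each ball strictly inside it. -/
theorem exists_mem_ball_lt_and_gt {a b a' b' : G}
    (h : ultrametricBall a' b' ⊂ ultrametricBall a b) :
    (∃ x ∈ ultrametricBall a b, ∀ y ∈ ultrametricBall a' b', x < y) ∧
      ∃ x ∈ ultrametricBall a b, ∀ y ∈ ultrametricBall a' b', y < x := by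
  obtain ⟨z, hz, hz'⟩ := Set.exists_of_ssubset h
  have ha' := mem_ultrametricBall.1 (h.1 (left_mem_ultrametricBall a' b'))
  rw [mem_ultrametricBall] at hz hz'
  rw [not_le] at hz'
  have hball : ArchimedeanClass.mk (a - b) ≤ ArchimedeanClass.mk |a' - z| := by
    rw [ArchimedeanClass.mk_abs, ← sub_sub_sub_cancel_left z a' a]
    exact (le_min hz ha').trans (ArchimedeanClass.min_le_mk_sub _ _)
  have hlt {y : G} (hy : y ∈ ultrametricBall a' b') : |a' - y| < |a' - z| := by
    refine ArchimedeanClass.lt_of_mk_lt_mk_of_nonneg ?_ (abs_nonneg _)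
    rw [ArchimedeanClass.mk_abs, ArchimedeanClass.mk_abs]
    exact hz'.trans_le hy
  refine ⟨⟨a' - |a' - z|, ?_, fun y hy => ?_⟩, a' + |a' - z|, ?_, fun y hy => ?_⟩
  · rw [mem_ultrametricBall, sub_sub_eq_add_sub, add_sub_right_comm]
    exact (le_min ha' hball).trans (ArchimedeanClass.min_le_mk_add _ _)
  · have := (le_abs_self _).trans_lt (hlt hy)
    rwa [sub_lt_comm]
  · rw [mem_ultrametricBall, ← sub_sub]
    exact (le_min ha' hball).trans (ArchimedeanClass.min_le_mk_sub _ _)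
  · have := (neg_le_abs _).trans_lt (hlt hy)
    rw [neg_sub] at this
    rwa [← sub_lt_iff_lt_add']

/-- A symmetrically complete ordered abelian group is spherically complete. -/
theorem SymmetricallyComplete.sphericallyComplete (h : SymmetricallyComplete G) :
    SphericallyComplete G := by
  intro S hne hball hchain
  by_contra hemp
  rw [Set.not_nonempty_iff_eq_empty] at hemp
  have hsplit (x : G) : ∃ B ∈ S, x ∉ B := by
    have : x ∉ ⋂₀ S := by simp [hemp]
    simpa using this
  have hmem {B : Set G} (hB : B ∈ S) : B.Nonempty := by
    obtain ⟨a, b, rfl⟩ := hball B hB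
    exact ⟨a, left_mem_ultrametricBall a b⟩
  -- An empty intersection leaves the chain without a smallest ball, so each ball has room on both
  -- sides of a smaller one.
  have hsub (B : S) : ∃ B' ∈ S, B' ⊂ B.1 := by
    obtain ⟨x, hx⟩ := hmem B.2
    obtain ⟨B', hB', hxB'⟩ := hsplit x
    rcases hchain.total hB' B.2 with hle | hle
    · exact ⟨B', hB', hle, fun hle' => hxB' (hle' hx)⟩
    · exact (hxB' (hle hx)).elim
  have hlow (B : S) : ∃ x ∈ B.1, ∃ B' ∈ S, ∀ y ∈ B', x < y := by
    obtain ⟨B', hB', hss⟩ := hsub B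
    obtain ⟨a, b, hab⟩ := hball B.1 B.2
    obtain ⟨a', b', rfl⟩ := hball B' hB'
    rw [hab] at hss ⊢
    obtain ⟨x, hx, hxy⟩ := (exists_mem_ball_lt_and_gt hss).1
    exact ⟨x, hx, _, hB', hxy⟩
  have hupp (B : S) : ∃ x ∈ B.1, ∃ B' ∈ S, ∀ y ∈ B', y < x := by
    obtain ⟨B', hB', hss⟩ := hsub B
    obtain ⟨a, b, hab⟩ := hball B.1 B.2
    obtain ⟨a', b', rfl⟩ := hball B' hB'
    rw [hab] at hss ⊢
    obtain ⟨x, hx, hxy⟩ := (exists_mem_ball_lt_and_gt hss).2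
    exact ⟨x, hx, _, hB', hxy⟩
  choose lo hlo hlo' using hlow
  choose up hup hup' using hupp
  obtain ⟨B₀, hB₀⟩ := hne
  -- The cut on which the chain closes in: each point misses some ball, and by convexity lies wholly
  -- below or wholly above it.
  let C : Cut G :=
    { lower := {x | ∃ B ∈ S, ∀ y ∈ B, x < y}
      upper := {x | ∃ B ∈ S, ∀ y ∈ B, y < x}
      lower_nonempty := ⟨lo ⟨B₀, hB₀⟩, hlo' _⟩
      upper_nonempty := ⟨up ⟨B₀, hB₀⟩, hup' _⟩
      union_eq := by
        rw [Set.eq_univ_iff_forall]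
        intro x
        obtain ⟨B, hB, hx⟩ := hsplit x
        obtain ⟨a, b, rfl⟩ := hball B hB
        by_contra hcon
        rw [Set.mem_union, not_or] at hcon
        obtain ⟨h₁, h₂⟩ := hcon
        have h₁' : ∃ y ∈ ultrametricBall a b, y ≤ x := by
          by_contra! hall
          exact h₁ ⟨_, hB, hall⟩
        have h₂' : ∃ y ∈ ultrametricBall a b, x ≤ y := by
          by_contra! hall
          exact h₂ ⟨_, hB, hall⟩
        obtain ⟨y, hy, hyx⟩ := h₁'
        obtain ⟨z, hz, hxz⟩ := h₂'
        exact hx ((ordConnected_ultrametricBall a b).out hy hz ⟨hyx, hxz⟩)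
      lt_of_mem := by
        rintro d ⟨B, hB, hd⟩ e ⟨B', hB', he⟩
        rcases hchain.total hB hB' with hle | hle
        · obtain ⟨y, hy⟩ := hmem hB
          exact (hd y hy).trans (he y (hle hy))
        · obtain ⟨y, hy⟩ := hmem hB'
          exact (hd y (hle hy)).trans (he y hy) }
  have hbelow (x : C.lower) : ∃ B : S, ∀ y ∈ B.1, x.1 < y := by
    obtain ⟨B, hB, hx⟩ := x.2
    exact ⟨⟨B, hB⟩, hx⟩
  have habove (x : C.upper) : ∃ B : S, ∀ y ∈ B.1, y < x.1 := by
    obtain ⟨B, hB, hx⟩ := x.2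
    exact ⟨⟨B, hB⟩, hx⟩
  choose below hbelow using hbelow
  choose above habove using habove
  -- `lo` and `below` form Tukey reductions in both directions between `C.lower` and the chain
  -- ordered by reverse inclusion; `up` and `above` do the same for `C.upper`.
  have hcofLower : C.cofLower = cof (S)ᵒᵈ := by
    apply le_antisymm
    · refine cof_le_of_tukey (α := C.lower) (β := (S)ᵒᵈ) (fun x => OrderDual.toDual (below x))
        (fun B => ⟨lo B.ofDual, hlo' _⟩) fun x B hle => ?_
      have hle' : B.ofDual.1 ⊆ (below x).1 := hle
      exact (hbelow x _ (hle' (hlo _))).le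
    · refine cof_le_of_tukey (α := (S)ᵒᵈ) (β := C.lower) (fun B => ⟨lo B.ofDual, hlo' _⟩)
        (fun x => OrderDual.toDual (below x)) fun B x hle => ?_
      have hle' : lo B.ofDual ≤ x.1 := hle
      change (below x).1 ⊆ B.ofDual.1
      refine (hchain.total (below x).2 B.ofDual.2).resolve_right fun hsub => ?_
      exact (hbelow x _ (hsub (hlo _))).not_ge hle'
  have hcoinUpper : C.coinUpper = cof (S)ᵒᵈ := by
    apply le_antisymm
    · refine cof_le_of_tukey (α := (C.upper)ᵒᵈ) (β := (S)ᵒᵈ)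
        (fun x => OrderDual.toDual (above x.ofDual))
        (fun B => OrderDual.toDual ⟨up B.ofDual, hup' _⟩) fun x B hle => ?_
      have hle' : B.ofDual.1 ⊆ (above x.ofDual).1 := hle
      exact (habove x.ofDual _ (hle' (hup _))).le
    · refine cof_le_of_tukey (α := (S)ᵒᵈ) (β := (C.upper)ᵒᵈ)
        (fun B => OrderDual.toDual ⟨up B.ofDual, hup' _⟩)
        (fun x => OrderDual.toDual (above x.ofDual)) fun B x hle => ?_
      have hle' : x.ofDual.1 ≤ up B.ofDual := hle
      change (above x.ofDual).1 ⊆ B.ofDual.1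
      refine (hchain.total (above x.ofDual).2 B.ofDual.2).resolve_right fun hsub => ?_
      exact (habove x.ofDual _ (hsub (hup _))).not_ge hle'
  exact h C (hcofLower.trans hcoinUpper.symm)

end Balls

/-! ### Symmetric completeness forces residue field `ℝ`. -/

section Field

variable {K : Type u} [Field K] [LinearOrder K] [IsStrictOrderedRing K]

/-- Without such an `x`, the rationals below and above `r` are cofinal and coinitial at a cut of
`K`, whose cofinality is then `(ℵ₀, ℵ₀)`. -/
theorem SymmetricallyComplete.exists_ratCast_le_and_le (h : SymmetricallyComplete K) (r : ℝ) :
    ∃ x : K, (∀ q : ℚ, (q : ℝ) < r → (q : K) ≤ x) ∧ ∀ q : ℚ, r < (q : ℝ) → x ≤ (q : K) := by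
  by_contra! hcon
  obtain ⟨q₀, hq₀⟩ := exists_rat_lt r
  obtain ⟨q₁, hq₁⟩ := exists_rat_gt r
  have hlow {q : ℚ} (hq : (q : ℝ) < r) : ∃ q' : ℚ, (q' : ℝ) < r ∧ (q : K) < q' := by
    obtain ⟨q', h₁, h₂⟩ := exists_rat_btwn hq
    exact ⟨q', h₂, by exact_mod_cast h₁⟩
  have hupp {q : ℚ} (hq : r < (q : ℝ)) : ∃ q' : ℚ, r < (q' : ℝ) ∧ (q' : K) < q := by
    obtain ⟨q', h₁, h₂⟩ := exists_rat_btwn hq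
    exact ⟨q', h₁, by exact_mod_cast h₂⟩
  let C : Cut K :=
    { lower := {x | ∃ q : ℚ, (q : ℝ) < r ∧ x < q}
      upper := {x | ∃ q : ℚ, r < (q : ℝ) ∧ q < x}
      lower_nonempty := ⟨_, hlow hq₀⟩
      upper_nonempty := ⟨_, hupp hq₁⟩
      union_eq := by
        rw [Set.eq_univ_iff_forall]
        intro x
        by_cases hx : ∀ q : ℚ, (q : ℝ) < r → (q : K) ≤ x
        · exact Or.inr (hcon x hx)
        · push Not at hx
          exact Or.inl hx
      lt_of_mem := by
        rintro d ⟨q, hq, hd⟩ e ⟨q', hq', he⟩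
        have hqq' : (q : ℝ) < q' := hq.trans hq'
        have hK : (q : K) < q' := by exact_mod_cast hqq'
        exact hd.trans (hK.trans he) }
  have hcofLower : C.cofLower = ℵ₀ := by
    apply le_antisymm
    · refine (cof_le (α := C.lower)
        (s := Set.range fun q : {q : ℚ // (q : ℝ) < r} => ⟨(q.1 : K), hlow q.2⟩) ?_).trans
        (le_aleph0_iff_set_countable.2 (Set.countable_range _))
      rintro ⟨x, q, hq, hx⟩
      exact ⟨_, ⟨⟨q, hq⟩, rfl⟩, hx.le⟩
    · refine C.aleph0_le_cofLower ?_
      rintro d ⟨q, hq, hd⟩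
      exact ⟨q, hlow hq, hd⟩
  have hcoinUpper : C.coinUpper = ℵ₀ := by
    apply le_antisymm
    · refine (cof_le (α := (C.upper)ᵒᵈ) (s := Set.range fun q : {q : ℚ // r < (q : ℝ)} =>
        OrderDual.toDual ⟨(q.1 : K), hupp q.2⟩) ?_).trans
        (le_aleph0_iff_set_countable.2 (Set.countable_range _))
      rintro ⟨x, q, hq, hx⟩
      exact ⟨_, ⟨⟨q, hq⟩, rfl⟩, hx.le⟩
    · refine C.aleph0_le_coinUpper ?_
      rintro d ⟨q, hq, hd⟩
      exact ⟨q, hupp hq, hd⟩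
  exact h C (hcofLower.trans hcoinUpper.symm)

theorem stdPart_eq_of_forall_ratCast {x : K} {r : ℝ} (h₁ : ∀ q : ℚ, (q : ℝ) < r → (q : K) ≤ x)
    (h₂ : ∀ q : ℚ, r < (q : ℝ) → x ≤ (q : K)) :
    0 ≤ ArchimedeanClass.mk x ∧ ArchimedeanClass.stdPart x = r := by
  obtain ⟨q₀, hq₀⟩ := exists_rat_lt r
  obtain ⟨q₁, hq₁⟩ := exists_rat_gt r
  have hx : 0 ≤ ArchimedeanClass.mk x :=
    (le_min (ArchimedeanClass.mk_ratCast_nonneg q₀) (ArchimedeanClass.mk_ratCast_nonneg q₁)).trans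
      (ArchimedeanClass.min_le_mk_of_le_of_le (h₁ q₀ hq₀) (h₂ q₁ hq₁))
  refine ⟨hx, le_antisymm ?_ ?_⟩
  · refine le_of_forall_rat_lt_imp_le fun q hq => ?_
    by_contra! hlt
    have := ArchimedeanClass.stdPart_monotoneOn hx (ArchimedeanClass.mk_ratCast_nonneg q) (h₂ q hlt)
    rw [ArchimedeanClass.stdPart_ratCast] at this
    exact this.not_gt hq
  · refine le_of_forall_rat_lt_imp_le fun q hq => ?_
    have := ArchimedeanClass.stdPart_monotoneOn (ArchimedeanClass.mk_ratCast_nonneg q) hx (h₁ q hq)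
    rwa [ArchimedeanClass.stdPart_ratCast] at this

/-- The residue field is `ℝ` if and only if every real number is the standard part of a finite
element. -/
theorem hasResidueFieldReal_iff :
    HasResidueFieldReal K ↔
      ∀ r : ℝ, ∃ x : K, 0 ≤ ArchimedeanClass.mk x ∧ ArchimedeanClass.stdPart x = r := by
  constructor
  · rintro ⟨f⟩ r
    obtain ⟨y, rfl⟩ := f.surjective r
    induction y with
    | mk y => exact ⟨y.1, y.2, ArchimedeanClass.stdPart_of_mk_nonneg (f : _ →+*o ℝ) y.2⟩
  · intro h
    -- Any ordered embedding into `ℝ` computes standard parts, so the hypothesis makes it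
    -- surjective.
    let f : ArchimedeanClass.FiniteResidueField K →+*o ℝ := Classical.ofNonempty
    have hf : Function.Surjective f := fun r => by
      obtain ⟨x, hx, rfl⟩ := h r
      exact ⟨_, (ArchimedeanClass.stdPart_of_mk_nonneg f hx).symm⟩
    have hinj : Function.Injective f := f.toRingHom.injective
    have hmono : StrictMono f := f.monotone'.strictMono_of_injective hinj
    exact ⟨{ RingEquiv.ofBijective f.toRingHom ⟨hinj, hf⟩ with
      map_le_map_iff' := fun {_ _} => hmono.le_iff_le }⟩

theorem SymmetricallyComplete.hasResidueFieldReal (h : SymmetricallyComplete K) :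
    HasResidueFieldReal K := by
  rw [hasResidueFieldReal_iff]
  intro r
  obtain ⟨x, h₁, h₂⟩ := h.exists_ratCast_le_and_le r
  exact ⟨x, stdPart_eq_of_forall_ratCast h₁ h₂⟩

end Field

/-! ### Centres of cuts, and sufficiency of the conditions. -/

theorem Cut.neg_neg {G : Type*} [AddCommGroup G] [LinearOrder G] [IsOrderedAddMonoid G]
    (C : Cut G) : C.neg.neg = C := by
  cases C
  simp [Cut.neg]

/-- In a spherically complete group, every cut admits a point lying in all ultrametric balls
spanned by an element below and an element above the cut. -/
theorem SphericallyComplete.exists_forall_mem_ball {G : Type*} [AddCommGroup G] [LinearOrder G]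
    [IsOrderedAddMonoid G] (h : SphericallyComplete G) (C : Cut G) :
    ∃ a, ∀ d ∈ C.lower, ∀ e ∈ C.upper, a ∈ ultrametricBall d e := by
  -- Balls spanned across the same cut are nested by radius: `d` and `d'` are no farther apart than
  -- one of the two spanning distances.
  have key {d e d' e' : G} (hd : d ∈ C.lower) (he : e ∈ C.upper) (hd' : d' ∈ C.lower)
      (he' : e' ∈ C.upper) (hle : ArchimedeanClass.mk (d - e) ≤ ArchimedeanClass.mk (d' - e')) :
      ultrametricBall d' e' ⊆ ultrametricBall d e := by
    intro g hg
    rw [mem_ultrametricBall] at *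
    have hdd' : ArchimedeanClass.mk (d - e) ≤ ArchimedeanClass.mk (d - d') := by
      rcases le_total d d' with hdd | hdd
      · refine ArchimedeanClass.mk_le_mk_of_abs ?_
        rw [abs_sub_comm d d', abs_sub_comm d e, abs_of_nonneg (sub_nonneg.2 hdd),
          abs_of_pos (sub_pos.2 (C.lt_of_mem d hd e he))]
        exact sub_le_sub_right (C.lt_of_mem d' hd' e he).le d
      · refine hle.trans (ArchimedeanClass.mk_le_mk_of_abs ?_)
        rw [abs_sub_comm d' e', abs_of_nonneg (sub_nonneg.2 hdd),
          abs_of_pos (sub_pos.2 (C.lt_of_mem d' hd' e' he'))]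
        exact sub_le_sub_right (C.lt_of_mem d hd e' he').le d'
    rw [← sub_add_sub_cancel d d' g]
    exact (le_min hdd' (hle.trans hg)).trans (ArchimedeanClass.min_le_mk_add _ _)
  obtain ⟨d, hd⟩ := C.lower_nonempty
  obtain ⟨e, he⟩ := C.upper_nonempty
  obtain ⟨a, ha⟩ := h {B | ∃ d ∈ C.lower, ∃ e ∈ C.upper, B = ultrametricBall d e}
    ⟨_, d, hd, e, he, rfl⟩ (by rintro _ ⟨d, -, e, -, rfl⟩; exact ⟨d, e, rfl⟩) (by
      rintro _ ⟨d, hd, e, he, rfl⟩ _ ⟨d', hd', e', he', rfl⟩ -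
      rcases le_total (ArchimedeanClass.mk (d - e)) (ArchimedeanClass.mk (d' - e')) with hle | hle
      · exact Or.inr (key hd he hd' he' hle)
      · exact Or.inl (key hd' he' hd he hle))
  exact ⟨a, fun d hd e he => ha _ ⟨d, hd, e, he, rfl⟩⟩

/-- A point below a cut `C` such that the class of the distance to an element `x ≥ a` determines
on which side of the cut `x` lies. -/
structure IsLowerCentre {G : Type*} [AddCommGroup G] [LinearOrder G] [IsOrderedAddMonoid G]
    (C : Cut G) (a : G) : Prop where
  mem : a ∈ C.lower
  mk_ne : ∀ d ∈ C.lower, a ≤ d → ∀ e ∈ C.upper,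
    ArchimedeanClass.mk (d - a) ≠ ArchimedeanClass.mk (e - a)

variable {K : Type u} [Field K] [LinearOrder K] [IsStrictOrderedRing K]

/-- A lower centre of a cut is either its greatest element, or the cut is induced by a cut of the
value group around this centre. -/
theorem IsLowerCentre.isGreatest_or_isInducedAt {C : Cut K} {a : K} (h : IsLowerCentre C a) :
    (∀ d ∈ C.lower, d ≤ a) ∨ ∃ C' : Cut (ValueGroup K), IsInducedAt C a C' := by
  rw [or_iff_not_imp_left]
  intro hmax
  push Not at hmax
  obtain ⟨d₁, hd₁, had₁⟩ := hmax
  have hgt {e : K} (he : e ∈ C.upper) : a < e := C.lt_of_mem a h.mem e he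
  obtain ⟨e₁, he₁⟩ := C.upper_nonempty
  have hdisj {d e : K} (hd : d ∈ C.lower) (had : a < d) (he : e ∈ C.upper) :
      valSub (hgt he) < valSub had := by
    refine lt_of_le_of_ne (valSub_anti had (C.lt_of_mem d hd e he).le) fun heq => ?_
    exact h.mk_ne d hd had.le e he (congrArg Subtype.val heq).symm
  refine ⟨{ lower := {γ | ∃ e, ∃ he : e ∈ C.upper, valSub (hgt he) = γ}
            upper := {γ | ∃ d ∈ C.lower, ∃ had : a < d, valSub had = γ}
            lower_nonempty := ⟨_, e₁, he₁, rfl⟩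
            upper_nonempty := ⟨_, d₁, hd₁, had₁, rfl⟩
            union_eq := ?_
            lt_of_mem := ?_ }, h.mem, ?_⟩
  · rw [Set.eq_univ_iff_forall]
    intro γ
    have hlt : a < a + posRep γ := lt_add_of_pos_right a (posRep_pos γ)
    have hγ : valSub hlt = γ := valSub_eq hlt (by rw [add_sub_cancel_left, mk_posRep])
    rcases C.mem_lower_or_mem_upper (a + posRep γ) with hm | hm
    · exact Or.inr ⟨_, hm, hlt, hγ⟩
    · exact Or.inl ⟨_, hm, hγ⟩
  · rintro _ ⟨e, he, rfl⟩ _ ⟨d, hd, had, rfl⟩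
    exact hdisj hd had he
  · refine fun {x} hx => ⟨fun hm => ⟨x, hm, hx, rfl⟩, ?_⟩
    rintro ⟨d, hd, had, heq⟩
    rw [← C.notMem_upper_iff]
    intro hm
    exact (hdisj hd had hm).ne heq.symm

theorem stdPart_eq_stdPart_iff {x y : K} (hx : 0 ≤ ArchimedeanClass.mk x)
    (hy : 0 ≤ ArchimedeanClass.mk y) :
    ArchimedeanClass.stdPart x = ArchimedeanClass.stdPart y ↔ 0 < ArchimedeanClass.mk (x - y) := by
  rw [← sub_eq_zero, ← ArchimedeanClass.stdPart_sub hx hy, ArchimedeanClass.stdPart_eq_zero]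
  exact ((le_min hx hy).trans (ArchimedeanClass.min_le_mk_sub x y)).lt_iff_ne'.symm

/-- If `a` is no centre, some `d₀` and `e₀` on the two sides lie at distances of the same class from
`a`. Measured in units of `t = d₀ - a`, the cut then has a real position, the supremum of the
standard parts from below. A lift `c` of it gives the centre `a + t * c`, of `C` or of `C.neg`
according to its side. -/
theorem exists_isLowerCentre_of_mem_lower (hres : HasResidueFieldReal K) {C : Cut K} {a : K}
    (haC : a ∈ C.lower) (ha : ∀ d ∈ C.lower, ∀ e ∈ C.upper, a ∈ ultrametricBall d e) :
    (∃ b, IsLowerCentre C b) ∨ ∃ b, IsLowerCentre C.neg b := by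
  by_cases hcen : IsLowerCentre C a
  · exact Or.inl ⟨a, hcen⟩
  have hex : ∃ d₀ ∈ C.lower, a ≤ d₀ ∧ ∃ e₀ ∈ C.upper,
      ArchimedeanClass.mk (d₀ - a) = ArchimedeanClass.mk (e₀ - a) := by
    by_contra! hcon
    exact hcen ⟨haC, hcon⟩
  obtain ⟨d₀, hd₀, had₀, e₀, he₀, heq⟩ := hex
  have hgt {e : K} (he : e ∈ C.upper) : a < e := C.lt_of_mem a haC e he
  set t := d₀ - a with ht
  have ht₀ : t ≠ 0 := fun h0 => by
    rw [h0, ArchimedeanClass.mk_zero, eq_comm, ArchimedeanClass.mk_eq_top_iff] at heq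
    exact (sub_pos.2 (hgt he₀)).ne' heq
  have htpos : 0 < t := lt_of_le_of_ne (sub_nonneg.2 had₀) ht₀.symm
  obtain ⟨n, hn⟩ := exists_le_mul_of_mk_le htpos heq.le
  have hq_mono {x y : K} (hxy : x ≤ y) : (x - a) / t ≤ (y - a) / t :=
    div_le_div_of_nonneg_right (sub_le_sub_right hxy a) htpos.le
  have hq_nonneg {x : K} (hx : a ≤ x) : 0 ≤ (x - a) / t :=
    div_nonneg (sub_nonneg.2 hx) htpos.le
  have hq_finite {x : K} (hx : a ≤ x) (hxe : x ≤ e₀) : 0 ≤ ArchimedeanClass.mk ((x - a) / t) := by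
    have hn' : 0 ≤ ArchimedeanClass.mk ((n : K) + 1) := by
      exact_mod_cast ArchimedeanClass.mk_natCast_nonneg (S := K) (n + 1)
    refine hn'.trans (mk_le_mk_of_le (hq_nonneg hx) ((hq_mono hxe).trans ?_))
    rwa [div_le_iff₀ htpos]
  have hd_finite {d : K} (hd : d ∈ C.lower) (had : a ≤ d) :
      0 ≤ ArchimedeanClass.mk ((d - a) / t) := hq_finite had (C.lt_of_mem d hd e₀ he₀).le
  set T : Set ℝ := {r | ∃ d ∈ C.lower, a ≤ d ∧ ArchimedeanClass.stdPart ((d - a) / t) = r}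
  have hT_one : (1 : ℝ) ∈ T :=
    ⟨d₀, hd₀, had₀, by rw [← ht, div_self ht₀, ArchimedeanClass.stdPart_one]⟩
  have hT_bdd : BddAbove T := by
    refine ⟨ArchimedeanClass.stdPart ((e₀ - a) / t), ?_⟩
    rintro _ ⟨d, hd, had, rfl⟩
    exact ArchimedeanClass.stdPart_monotoneOn (hd_finite hd had)
      (hq_finite (hgt he₀).le le_rfl) (hq_mono (C.lt_of_mem d hd e₀ he₀).le)
  obtain ⟨c, hc, hcR⟩ := hasResidueFieldReal_iff.1 hres (sSup T)
  have hR : 1 ≤ sSup T := le_csSup hT_bdd hT_one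
  have hcpos : 0 < c := by
    by_contra! hle
    have := ArchimedeanClass.stdPart_nonpos hle
    linarith
  have hdist (x : K) : (x - a) / t - c = (x - (a + t * c)) / t := by
    field_simp
    ring
  have hab : a ≤ a + t * c := (lt_add_of_pos_right a (mul_pos htpos hcpos)).le
  have hmk_div {x y : K} (hxy : ArchimedeanClass.mk x = ArchimedeanClass.mk y) :
      ArchimedeanClass.mk (x / t) = ArchimedeanClass.mk (y / t) := by
    rw [ArchimedeanClass.mk_div, ArchimedeanClass.mk_div, hxy]
  -- Points `d`, `e` both infinitesimally near position `c` would span a ball of radius finer than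
  -- `v t`. As it contains `a`, also `(d - a) / t` and hence `c` would be infinitesimal, but `c` has
  -- standard part at least `1`.
  have hcontra {d e : K} (hd : d ∈ C.lower) (he : e ∈ C.upper)
      (h₁ : 0 < ArchimedeanClass.mk ((d - a) / t - c))
      (h₂ : 0 < ArchimedeanClass.mk ((e - a) / t - c)) : False := by
    have hball := mem_ultrametricBall.1 (ha d hd e he)
    have h₃ : ArchimedeanClass.mk ((d - a) / t - (e - a) / t) ≤
        ArchimedeanClass.mk ((d - a) / t) := by
      rw [← sub_div, sub_sub_sub_cancel_right, div_eq_mul_inv, div_eq_mul_inv,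
        ArchimedeanClass.mk_mul, ArchimedeanClass.mk_mul]
      gcongr
    have h₄ : 0 < ArchimedeanClass.mk ((d - a) / t - (e - a) / t) := by
      rw [← sub_sub_sub_cancel_right _ _ c]
      exact (lt_min h₁ h₂).trans_le (ArchimedeanClass.min_le_mk_sub _ _)
    have h₅ : 0 < ArchimedeanClass.mk c := by
      rw [← sub_sub_cancel ((d - a) / t) c]
      exact (lt_min (h₄.trans_le h₃) h₁).trans_le (ArchimedeanClass.min_le_mk_sub _ _)
    rw [ArchimedeanClass.stdPart_of_mk_ne_zero h₅.ne'] at hcR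
    linarith
  rcases C.mem_lower_or_mem_upper (a + t * c) with hb | hb
  · refine Or.inl ⟨a + t * c, hb, fun d hd hbd e he hmk => ?_⟩
    have had : a ≤ d := hab.trans hbd
    have hcd : c ≤ (d - a) / t := by
      rw [← sub_nonneg, hdist]
      exact div_nonneg (sub_nonneg.2 hbd) htpos.le
    have hstd : ArchimedeanClass.stdPart ((d - a) / t) = ArchimedeanClass.stdPart c := by
      refine le_antisymm ?_ (ArchimedeanClass.stdPart_monotoneOn hc (hd_finite hd had) hcd)
      rw [hcR]
      exact le_csSup hT_bdd ⟨d, hd, had, rfl⟩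
    have h₁ := (stdPart_eq_stdPart_iff (hd_finite hd had) hc).1 hstd
    refine hcontra hd he h₁ ?_
    rw [hdist] at h₁ ⊢
    rwa [← hmk_div hmk]
  · refine Or.inr ⟨-(a + t * c), by simpa [Cut.neg] using hb, fun e' he' hbe' d' hd' hmk => ?_⟩
    have he : -e' ∈ C.upper := he'
    have hd : -d' ∈ C.lower := hd'
    have heb : -e' ≤ a + t * c := neg_le.1 hbe'
    have hmk' : ArchimedeanClass.mk (-e' - (a + t * c)) =
        ArchimedeanClass.mk (-d' - (a + t * c)) := by
      rw [← ArchimedeanClass.mk_neg, ← ArchimedeanClass.mk_neg (-d' - (a + t * c))]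
      convert hmk using 2 <;> ring
    have hec : (-e' - a) / t ≤ c := by
      rw [← sub_nonpos, hdist]
      exact div_nonpos_of_nonpos_of_nonneg (sub_nonpos.2 heb) htpos.le
    have hfin : 0 ≤ ArchimedeanClass.mk ((-e' - a) / t) :=
      hc.trans (mk_le_mk_of_le (hq_nonneg (hgt he).le) hec)
    have hstd : ArchimedeanClass.stdPart ((-e' - a) / t) = ArchimedeanClass.stdPart c := by
      refine le_antisymm (ArchimedeanClass.stdPart_monotoneOn hfin hc hec) ?_
      rw [hcR]
      -- Any point above the cut bounds `T`, so its standard part cannot fall below the supremum.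
      refine csSup_le ⟨1, hT_one⟩ ?_
      rintro _ ⟨d, hd, had, rfl⟩
      exact ArchimedeanClass.stdPart_monotoneOn (hd_finite hd had) hfin
        (hq_mono (C.lt_of_mem d hd _ he).le)
    have h₂ := (stdPart_eq_stdPart_iff hfin hc).1 hstd
    refine hcontra hd he ?_ h₂
    rw [hdist] at h₂ ⊢
    rwa [← hmk_div hmk']

/-- Up to negation, every cut of a spherically complete field with residue field `ℝ` has a lower
centre. -/
theorem SphericallyComplete.exists_isLowerCentre (hsph : SphericallyComplete K)
    (hres : HasResidueFieldReal K) (C : Cut K) :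
    (∃ b, IsLowerCentre C b) ∨ ∃ b, IsLowerCentre C.neg b := by
  obtain ⟨a, ha⟩ := hsph.exists_forall_mem_ball C
  rcases C.mem_lower_or_mem_upper a with haC | haC
  · exact exists_isLowerCentre_of_mem_lower hres haC ha
  · have h := exists_isLowerCentre_of_mem_lower hres (C := C.neg) (a := -a)
      (by simpa [Cut.neg] using haC) fun d hd e he => by
        -- Negation swaps the two spanning points; by the ultrametric inequality either of them
        -- serves as centre of the ball.
        have hball := mem_ultrametricBall.1 (ha (-e) he (-d) hd)
        rw [mem_ultrametricBall]
        have hde : -e - -d = d - e := by ring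
        have hda : d - -a = (d - e) - (-e - a) := by ring
        rw [hde] at hball
        rw [hda]
        exact (le_min le_rfl hball).trans (ArchimedeanClass.min_le_mk_sub _ _)
    rwa [Cut.neg_neg, or_comm] at h

/-- In a spherically complete field with residue field `ℝ` and strongly symmetrically complete
value group, every cut is strongly asymmetric or principal, up to negation: a property of cuts
invariant under negation holds as soon as it does for these two kinds of cuts. -/
theorem SphericallyComplete.cut_induction (hsph : SphericallyComplete K)
    (hres : HasResidueFieldReal K) (hval : StronglySymmetricallyComplete (ValueGroup K))
    {P : Cut K → Prop} (hneg : ∀ C : Cut K, P C.neg → P C)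
    (hstrong : ∀ C : Cut K, C.IsStronglyAsymmetric → P C)
    (hprincipal : ∀ (C : Cut K), ∀ a ∈ C.lower, (∀ d ∈ C.lower, d ≤ a) → P C) (C : Cut K) :
    P C := by
  have key {C : Cut K} {b : K} (h : IsLowerCentre C b) : P C := by
    rcases h.isGreatest_or_isInducedAt with hmax | ⟨C', hC'⟩
    · exact hprincipal C b h.mem hmax
    · exact hstrong C (hC'.isStronglyAsymmetric_iff.2 (hval C'))
  rcases hsph.exists_isLowerCentre hres C with ⟨b, hb⟩ | ⟨b, hb⟩
  · exact key hb
  · exact hneg C (key hb)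

theorem symmetricallyComplete_of_sphericallyComplete (hsph : SphericallyComplete K)
    (hres : HasResidueFieldReal K) (hval : StronglySymmetricallyComplete (ValueGroup K)) :
    SymmetricallyComplete K := by
  refine hsph.cut_induction hres hval (fun C => C.isAsymmetric_neg.1)
    (fun C hC => hC.1) fun C a ha hmax => ?_
  rw [Cut.IsAsymmetric, C.cofLower_eq_one_of_isGreatest ha hmax]
  exact (one_lt_aleph0.trans_le (aleph0_le_coinUpper_of_isGreatest ha hmax)).ne

theorem stronglySymmetricallyComplete_of_sphericallyComplete (hsph : SphericallyComplete K)
    (hres : HasResidueFieldReal K) (hval : StronglySymmetricallyComplete (ValueGroup K))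
    (hcof : ℵ₀ < cof (ValueGroup K)) : StronglySymmetricallyComplete K := by
  refine hsph.cut_induction hres hval (fun C => C.isStronglyAsymmetric_neg.1)
    (fun C hC => hC) fun C a ha hmax => ?_
  have hlt : ℵ₀ < C.coinUpper := hcof.trans_le (cof_valueGroup_le_coinUpper ha hmax)
  rw [Cut.IsStronglyAsymmetric, C.cofLower_eq_one_of_isGreatest ha hmax]
  exact ⟨(one_lt_aleph0.trans hlt).ne, Or.inr hlt⟩

/-! ### The cut at zero, and necessity of uncountable cofinalities. -/

/-- The cut between the nonpositive and the positive elements. -/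
def zeroCut (K : Type*) [Field K] [LinearOrder K] [IsStrictOrderedRing K] : Cut K where
  lower := Set.Iic 0
  upper := Set.Ioi 0
  lower_nonempty := ⟨0, le_rfl⟩
  upper_nonempty := ⟨1, zero_lt_one⟩
  union_eq := Set.Iic_union_Ioi
  lt_of_mem _ hd _ he := hd.trans_lt he

theorem cofLower_zeroCut : (zeroCut K).cofLower = 1 :=
  (zeroCut K).cofLower_eq_one_of_isGreatest Set.self_mem_Iic fun _ h => h

theorem coinUpper_zeroCut_le_cof : (zeroCut K).coinUpper ≤ cof K := by
  refine cof_le_of_tukey (α := ((zeroCut K).upper)ᵒᵈ) (fun x => (x.ofDual.1)⁻¹)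
    -- The maximum with `1` only ensures a positive element to invert.
    (fun y => OrderDual.toDual ⟨(max 1 y)⁻¹,
      Set.mem_Ioi.2 (inv_pos.2 (zero_lt_one.trans_le (le_max_left _ _)))⟩) fun x y hle => ?_
  have hx : 0 < x.ofDual.1 := x.ofDual.2
  change (max 1 y)⁻¹ ≤ x.ofDual.1
  exact inv_le_of_inv_le₀ hx (hle.trans (le_max_right _ _))

theorem coinUpper_zeroCut_le_max : (zeroCut K).coinUpper ≤ max ℵ₀ (cof (ValueGroup K)) := by
  refine cof_le_max_aleph0 (α := ((zeroCut K).upper)ᵒᵈ)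
    (fun γ n => OrderDual.toDual ⟨posRep γ / ((n : K) + 1),
      Set.mem_Ioi.2 (div_pos (posRep_pos γ) (by positivity))⟩) fun x => ?_
  have hx : 0 < x.ofDual.1 := x.ofDual.2
  refine ⟨valSub hx, fun γ hγ => ?_⟩
  have hγ' : ArchimedeanClass.mk (x.ofDual.1 - 0) ≤ γ.1 := hγ
  rw [sub_zero, ← mk_posRep] at hγ'
  obtain ⟨n, hn⟩ := exists_le_mul_of_mk_le hx hγ'
  refine ⟨n, ?_⟩
  change posRep γ / ((n : K) + 1) ≤ x.ofDual.1
  rwa [div_le_iff₀ (by positivity), mul_comm]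

/-- Large elements of `K` have small classes, and the multiples of one positive representative bound
all elements of its class. -/
theorem cof_le_max_coinitiality_valueGroup :
    cof K ≤ max ℵ₀ (coinitiality (ValueGroup K)) := by
  refine cof_le_max_aleph0 (β := (ValueGroup K)ᵒᵈ)
    (fun γ n => ((n : K) + 1) * posRep γ.ofDual) fun x => ?_
  have hpos : (0 : K) < max 1 x := zero_lt_one.trans_le (le_max_left _ _)
  refine ⟨OrderDual.toDual (valSub hpos), fun γ hγ => ?_⟩
  have hγ' : γ.ofDual.1 ≤ ArchimedeanClass.mk (max 1 x - 0) := hγ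
  rw [sub_zero, ← mk_posRep] at hγ'
  obtain ⟨n, hn⟩ := exists_le_mul_of_mk_le (posRep_pos γ.ofDual) hγ'
  exact ⟨n, (le_max_right _ _).trans hn⟩

theorem coinitiality_eq_cof (G : Type*) [AddCommGroup G] [LinearOrder G] [IsOrderedAddMonoid G] :
    coinitiality G = cof G :=
  (OrderIso.cof_congr (OrderIso.neg G)).symm

theorem StronglySymmetricallyComplete.aleph0_lt_coinUpper_zeroCut
    (h : StronglySymmetricallyComplete K) : ℵ₀ < (zeroCut K).coinUpper := by
  refine (h (zeroCut K)).2.resolve_left ?_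
  rw [cofLower_zeroCut]
  exact one_lt_aleph0.not_gt

theorem StronglySymmetricallyComplete.aleph0_lt_cof (h : StronglySymmetricallyComplete K) :
    ℵ₀ < cof K :=
  h.aleph0_lt_coinUpper_zeroCut.trans_le coinUpper_zeroCut_le_cof

theorem StronglySymmetricallyComplete.extremelySymmetricallyComplete
    (h : StronglySymmetricallyComplete K) : ExtremelySymmetricallyComplete K :=
  ⟨h, (coinitiality_eq_cof K).symm ▸ h.aleph0_lt_cof, h.aleph0_lt_cof⟩

theorem StronglySymmetricallyComplete.valueGroup (h : StronglySymmetricallyComplete K) :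
    ExtremelySymmetricallyComplete (ValueGroup K) := by
  refine ⟨h.symmetricallyComplete.valueGroup, ?_, ?_⟩
  · simpa using h.aleph0_lt_cof.trans_le cof_le_max_coinitiality_valueGroup
  · simpa using h.aleph0_lt_coinUpper_zeroCut.trans_le coinUpper_zeroCut_le_max

end SymmetricCompleteness

theorem theorem1p4 {K : Type*} [Field K] [LinearOrder K] [IsStrictOrderedRing K] :
    (SymmetricCompleteness.SymmetricallyComplete K ↔
      SymmetricCompleteness.SphericallyComplete K ∧
      SymmetricCompleteness.HasResidueFieldReal K ∧
      SymmetricCompleteness.StronglySymmetricallyComplete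
        (SymmetricCompleteness.ValueGroup K)) ∧
    List.TFAE [
      SymmetricCompleteness.StronglySymmetricallyComplete K,
      SymmetricCompleteness.ExtremelySymmetricallyComplete K,
      SymmetricCompleteness.SphericallyComplete K ∧
        SymmetricCompleteness.HasResidueFieldReal K ∧
        SymmetricCompleteness.ExtremelySymmetricallyComplete
          (SymmetricCompleteness.ValueGroup K)] := by
  refine ⟨⟨fun h => ⟨h.sphericallyComplete, h.hasResidueFieldReal, h.valueGroup⟩,
    fun ⟨hsph, hres, hval⟩ =>
      SymmetricCompleteness.symmetricallyComplete_of_sphericallyComplete hsph hres hval⟩, ?_⟩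
  tfae_have 1 → 2 := fun h => h.extremelySymmetricallyComplete
  tfae_have 2 → 3 := fun h =>
    ⟨h.1.symmetricallyComplete.sphericallyComplete, h.1.symmetricallyComplete.hasResidueFieldReal,
      h.1.valueGroup⟩
  tfae_have 3 → 1 := fun ⟨hsph, hres, hval⟩ =>
    SymmetricCompleteness.stronglySymmetricallyComplete_of_sphericallyComplete hsph hres hval.1
      hval.2.2
  tfae_finish
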